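/- Let $\mathscr P$ be a finite set of processes and let $\Sigma$ be a finite alphabet with a location function $\mathrm{loc}$ that maps each letter to a non-empty subset of $\mathscr P$, each process lying in $\mathrm{loc}(a)$ for some letter $a$. Two letters are dependent if their locations meet. A trace over $\Sigma$ is a finite poset $(E,\le)$ of events with a labelling $\lambda\colon E\to\Sigma$ such that $(\lambda(e),\lambda(f))$ is dependent whenever $f$ covers $e$, and $e,f$ are comparable whenever $\lambda(e),\lambda(f)$ are dependent. An $i$-event is an event $e$ with $i\in\mathrm{loc}(\lambda(e))$. For an event $e$, let ${\Downarrow}e$ be the prefix (downward closed subtrace) $\{f\mid f<e\}$; for a process $i$, let ${\downarrow}E_i$ be the prefix of all events below some $i$-event. For a set $\Gamma$, put $\mathrm{loc}(a,\gamma)=\mathrm{loc}(a)$ on $\Sigma\times\Gamma$; a $\Gamma$-labelling function adds a label in $\Gamma$ to each event of each trace over $\Sigma$, keeping the poset. An asynchronous automaton $A=(\{S_i\},\{\delta_a\},s_{\mathrm{in}})$ over $\Sigma$ has a finite set $S_i$ of local states for each process, a map $\delta_a\colon S_a\to S_a$ on $S_a=\prod_{i\in\mathrm{loc}(a)}S_i$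 for each letter $a$, and an initial global state $s_{\mathrm{in}}\in S=\prod_{i\in\mathscr P}S_i$. Let $\Delta_a\colon S\to S$ be the extension of $\delta_a$ that leaves the other components unchanged, and let $A(t)\in S$ be the global state reached from $s_{\mathrm{in}}$ on the trace $t$ (by applying the maps $\Delta_{\lambda(e)}$ along any linearization of $t$). The global-state labelling function $\zeta_A$ labels each event $e$ of a trace by $A({\Downarrow}e)\in S$. A $\Gamma$-transducer is an asynchronous automaton $A$ with maps $\mu_a\colon S_a\to\Gamma$; it computes the labelling function that labels an event $e$ with letter $a$ by $\mu_a(s_a)$, where $s=A({\Downarrow}e)$ and $s_a$ is the restriction of $s$ to $\mathrm{loc}(a)$. Let $\Gamma=\{0,1\}^{\mathscr P\times\mathscr P}$. The primary order labelling function $\theta^Y$ labels an event $e$ by the $\gamma\in\Gamma$ with $\gamma_{i,j}=1$ if and only if the last $i$-event $e_i$ and the last $j$-event $e_j$ in ${\Downarrow}e$ both exist and $e_i\le e_j$. Let $\widehat{\mathcal G}=(\{\Upsilon_i\},\{\nabla_a\},v_{\mathrm{in}},\{\nu_a\})$ be a $\Gamma$-transducer computing $\theta^Y$ (its underlying automaton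 $\mathcal G$ is called a gossip automaton). For $a\in\Sigma$, $\gamma\in\Gamma$ and $q\in S^{\mathrm{loc}(a)}$, let $\mathsf{globalstate}_{(a,\gamma)}(q)\in S$ be the global state whose $i$-component, for $i\in\mathscr P$, is $q(j)(i)$ for some chosen $j\in\mathrm{loc}(a)$ with $\gamma_{i,j}=1$ if there is such a $j$, and $s_{\mathrm{in}}(i)$ otherwise; the choice of $j$ depends on $a,\gamma,i$ and is otherwise arbitrary. The global-state detector $A^g$ is the asynchronous automaton over $\Sigma\times\Gamma$ in which each process has the set $S$ of local states and starts in $s_{\mathrm{in}}$, and in which the $(a,\gamma)$-transition maps $q\in S^{\mathrm{loc}(a)}$ to the constant family with value $\Delta_a(\mathsf{globalstate}_{(a,\gamma)}(q))$. The $\theta^Y$-restricted local cascade product $A^{\mathcal G}$ of $\mathcal G$ and $A^g$ has the local states $\Upsilon_i\times S$, the initial state $(v_{\mathrm{in}},(s_{\mathrm{in}},\dots,s_{\mathrm{in}}))$ and, for $a\in\Sigma$, the transition $(\upsilon,q)\mapsto(\nabla_a(\upsilon),\delta^g_{(a,\nu_a(\upsilon))}(q))$, where $\delta^g$ denotes the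 transitions of $A^g$. Let $\widehat A^{\mathcal G}$ be the $S$-transducer on $A^{\mathcal G}$ with the output functions $\xi_a(\upsilon,q)=\mathsf{globalstate}_{(a,\nu_a(\upsilon))}(q)$. Then, for every asynchronous automaton $A$ over $\Sigma$, every such $\widehat{\mathcal G}$ and every choice of the processes $j$ as above, $\widehat A^{\mathcal G}$ computes $\zeta_A$. Moreover, each process of the detector tracks the best global state of $A$ it knows: for every trace $t$ and every process $i$, if $A^{\mathcal G}(t)=(\upsilon,q)$ then $q_i=A({\downarrow}E_i)$. -/

import Mathlib

universe u v w w'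

/-- A distributed alphabet over the set `P` of processes with (total) alphabet `α`, given by its
location function. The letters of process `i` are those `a` with `i ∈ loc a`; each process has a
letter, and each letter belongs to some process. -/
structure DistributedAlphabet (P : Type*) (α : Type*) where
  loc : α → Set P
  loc_nonempty : ∀ a, (loc a).Nonempty
  exists_letter : ∀ i, ∃ a, i ∈ loc a

namespace DistributedAlphabet

variable {P α : Type*}

/-- The dependence relation: the two letters share a process. -/
def Dep (D : DistributedAlphabet P α) (a b : α) : Prop :=
  (D.loc a ∩ D.loc b).Nonempty

/-- The alphabet `α × Γ`, where `(a, γ)` has the location of `a`. -/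
def prod (D : DistributedAlphabet P α) (Γ : Type*) [Nonempty Γ] :
    DistributedAlphabet P (α × Γ) where
  loc p := D.loc p.1
  loc_nonempty p := D.loc_nonempty p.1
  exists_letter i := by
    obtain ⟨a, ha⟩ := D.exists_letter i
    exact ⟨(a, Classical.arbitrary Γ), ha⟩

end DistributedAlphabet

/-- A trace over a distributed alphabet: a finite labelled poset in which immediate successors
carry dependent letters and events with dependent letters are comparable. -/
structure Trace {P α : Type*} (D : DistributedAlphabet P α) where
  E : Type
  finite : Finite E
  order : PartialOrder E
  label : E → α
  dep_of_covBy : ∀ e f : E, e ⋖ f → D.Dep (label e) (label f)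
  comparable_of_dep : ∀ e f : E, D.Dep (label e) (label f) → e ≤ f ∨ f ≤ e

namespace Trace

variable {P α : Type*} {D : DistributedAlphabet P α}

instance (t : Trace D) : Finite t.E := t.finite

instance (t : Trace D) : PartialOrder t.E := t.order

/-- The `i`-events of a trace. -/
def events (t : Trace D) (i : P) : Set t.E := {e | i ∈ D.loc (t.label e)}

/-- The prefix of a trace given by a downward closed set of events. -/
def restrict (t : Trace D) (c : Set t.E) (hc : IsLowerSet c) : Trace D where
  E := c
  finite := inferInstance
  order := inferInstance
  label e := t.label e
  dep_of_covBy e f h := by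
    refine t.dep_of_covBy e f ⟨h.1, fun g h₁ h₂ => ?_⟩
    exact h.2 (c := ⟨g, hc (le_of_lt h₂) f.2⟩) h₁ h₂
  comparable_of_dep e f h := t.comparable_of_dep e f h

/-- The strict past of an event, as a prefix of the trace. -/
def strictPast (t : Trace D) (e : t.E) : Trace D :=
  t.restrict (Set.Iio e) (isLowerSet_Iio e)

/-- The `i`-view of a trace: the prefix of all events below some `i`-event. -/
def view (t : Trace D) (i : P) : Trace D :=
  t.restrict (lowerClosure (t.events i)) (lowerClosure (t.events i)).lower

/-- The same poset, with the label `μ e ∈ Γ` added to each event `e`. -/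
def decorate (t : Trace D) {Γ : Type*} [Nonempty Γ] (μ : t.E → Γ) : Trace (D.prod Γ) where
  E := t.E
  finite := t.finite
  order := t.order
  label e := (t.label e, μ e)
  dep_of_covBy e f h := t.dep_of_covBy e f h
  comparable_of_dep e f h := t.comparable_of_dep e f h

/-- The list `l` is a linearization: it lists all events (each once), compatibly with the order. -/
def IsLinearization (t : Trace D) (l : List t.E) : Prop :=
  (∀ e, e ∈ l) ∧ l.Pairwise (fun e f => ¬ f ≤ e)

theorem exists_isLinearization (t : Trace D) : ∃ l, t.IsLinearization l := by
  classical
  have : Fintype t.E := Fintype.ofFinite _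
  have : Fintype (LinearExtension t.E) := inferInstanceAs (Fintype t.E)
  refine ⟨(Finset.univ : Finset (LinearExtension t.E)).sort (· ≤ ·), ?_, ?_⟩
  · intro e
    exact (Finset.mem_sort (α := LinearExtension t.E) (· ≤ ·)).2 (Finset.mem_univ _)
  · have h₁ := Finset.pairwise_sort (Finset.univ : Finset (LinearExtension t.E)) (· ≤ ·)
    have h₂ := Finset.sort_nodup (Finset.univ : Finset (LinearExtension t.E)) (· ≤ ·)
    refine (h₁.and h₂).imp ?_
    intro e f h hfe
    exact h.2 (le_antisymm h.1 ((toLinearExtension (α := t.E)).monotone hfe))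

/-- A linearization of the trace. -/
noncomputable def linearization (t : Trace D) : List t.E := t.exists_isLinearization.choose

/-- `f` is the last `i`-event in the strict past of `e`. -/
def IsLast (t : Trace D) (e : t.E) (i : P) (f : t.E) : Prop :=
  IsGreatest (Set.Iio e ∩ t.events i) f

/-- In the strict past of `e`, the last `i`-event and the last `j`-event both exist, and the former
is below the latter. -/
def PrimaryLe (t : Trace D) (e : t.E) (i j : P) : Prop :=
  ∃ f g, t.IsLast e i f ∧ t.IsLast e j g ∧ f ≤ g

open Classical in
/-- The primary order labelling function: each event `e` is decorated with the truth values of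
`PrimaryLe e i j`, for all processes `i` and `j`. -/
noncomputable def primaryOrder (t : Trace D) : Trace (D.prod (P × P → Bool)) :=
  t.decorate fun e p => decide (t.PrimaryLe e p.1 p.2)

end Trace

/-- An asynchronous automaton: finite sets of local states, a transition function on `a`-states for
each letter `a`, and an initial global state (so the sets of local states are non-empty). -/
structure AsyncAutomaton {P : Type u} {α : Type v} (D : DistributedAlphabet P α) where
  S : P → Type w
  finite : ∀ i, Finite (S i)
  δ : (a : α) → ((i : D.loc a) → S i) → ((i : D.loc a) → S i)
  init : (i : P) → S i

namespace AsyncAutomaton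

variable {P : Type u} {α : Type v} {D : DistributedAlphabet P α}

instance (A : AsyncAutomaton D) (i : P) : Finite (A.S i) := A.finite i

/-- Global states. -/
abbrev GlobalState (A : AsyncAutomaton D) := (i : P) → A.S i

/-- `a`-states. -/
abbrev LocState (A : AsyncAutomaton D) (a : α) := (i : D.loc a) → A.S i

instance (A : AsyncAutomaton D) : Nonempty A.GlobalState := ⟨A.init⟩

/-- The `a`-state of a global state. -/
def proj (A : AsyncAutomaton D) (a : α) (s : A.GlobalState) : A.LocState a := fun i => s i

open Classical in
/-- The extension of the transition function of `a` to global states. -/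
noncomputable def step (A : AsyncAutomaton D) (a : α) (s : A.GlobalState) : A.GlobalState :=
  fun i => if h : i ∈ D.loc a then A.δ a (A.proj a s) ⟨i, h⟩ else s i

/-- The global transition function of a word. -/
noncomputable def stepWord (A : AsyncAutomaton D) (w : List α) (s : A.GlobalState) :
    A.GlobalState :=
  w.foldl (fun s a => A.step a s) s

/-- The global state reached on a trace from the initial state, by executing the letters of the
trace along a linearization. The choice of the linearization is irrelevant (`run_eq`). -/
noncomputable def run (A : AsyncAutomaton D) (t : Trace D) : A.GlobalState :=
  A.stepWord (t.linearization.map t.label) A.init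

theorem step_comm (A : AsyncAutomaton D) {a b : α} (h : ¬ D.Dep a b) (s : A.GlobalState) :
    A.step a (A.step b s) = A.step b (A.step a s) := by
  have key : ∀ {a b : α}, ¬ D.Dep a b → A.proj a (A.step b s) = A.proj a s := by
    intro a b h
    funext i
    have : (i : P) ∉ D.loc b := fun hi => h ⟨i, i.2, hi⟩
    simp [proj, step, this]
  have h' : ¬ D.Dep b a := fun ⟨i, hi⟩ => h ⟨i, hi.2, hi.1⟩
  funext i
  by_cases ha : i ∈ D.loc a
  · have hb : i ∉ D.loc b := fun hi => h ⟨i, ha, hi⟩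
    rw [step, dif_pos ha, key h, step, dif_neg hb, step, dif_pos ha]
  · by_cases hb : i ∈ D.loc b
    · rw [step, dif_neg ha, step, dif_pos hb, step, dif_pos hb, key h']
    · simp [step, ha, hb]

theorem stepWord_comm (A : AsyncAutomaton D) (a : α) (w : List α)
    (h : ∀ b ∈ w, ¬ D.Dep a b) (s : A.GlobalState) :
    A.stepWord w (A.step a s) = A.step a (A.stepWord w s) := by
  induction w generalizing s with
  | nil => rfl
  | cons b w ih =>
    simp only [List.mem_cons, forall_eq_or_imp] at h
    simp only [stepWord, List.foldl_cons] at ih ⊢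
    rw [← A.step_comm h.1, ih h.2]

theorem stepWord_eq (A : AsyncAutomaton D) (t : Trace D) (l l' : List t.E) (hp : l.Perm l')
    (h : l.Pairwise (fun e f => ¬ f ≤ e)) (h' : l'.Pairwise (fun e f => ¬ f ≤ e))
    (s : A.GlobalState) : A.stepWord (l.map t.label) s = A.stepWord (l'.map t.label) s := by
  induction l generalizing l' s with
  | nil => rw [hp.nil_eq]
  | cons e l ih =>
    obtain ⟨u, v, rfl⟩ := List.append_of_mem (hp.subset List.mem_cons_self)
    have hp' : l.Perm (u ++ v) := (hp.trans List.perm_middle).cons_inv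
    rw [List.pairwise_cons] at h
    have hu : ∀ b ∈ u.map t.label, ¬ D.Dep (t.label e) b := by
      intro b hb hd
      obtain ⟨f, hf, rfl⟩ := List.mem_map.1 hb
      rcases t.comparable_of_dep e f hd with h₁ | h₁
      · exact (List.pairwise_append.1 h').2.2 f hf e List.mem_cons_self h₁
      · exact h.1 f (hp'.symm.subset (List.mem_append_left _ hf)) h₁
    have hs : (u ++ v).Pairwise (fun e f => ¬ f ≤ e) :=
      h'.sublist (List.Sublist.append_left (List.sublist_cons_self e v) u)
    have h₁ := ih (u ++ v) hp' h.2 hs (A.step (t.label e) s)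
    have h₂ := A.stepWord_comm (t.label e) (u.map t.label) hu s
    simp only [stepWord, List.map_append, List.map_cons, List.foldl_append, List.foldl_cons]
      at h₁ h₂ ⊢
    rw [h₁, h₂]

/-- The global state reached on a trace does not depend on the linearization. -/
theorem run_eq (A : AsyncAutomaton D) (t : Trace D) (l : List t.E) (hl : t.IsLinearization l) :
    A.run t = A.stepWord (l.map t.label) A.init := by
  have h := t.exists_isLinearization.choose_spec
  have nd : ∀ {m : List t.E}, m.Pairwise (fun e f => ¬ f ≤ e) → m.Nodup := fun hm =>
    hm.imp fun hef heq => hef heq.ge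
  exact A.stepWord_eq t _ _ ((List.perm_ext_iff_of_nodup (nd h.2) (nd hl.2)).2
    fun e => ⟨fun _ => hl.1 e, fun _ => h.1 e⟩) h.2 hl.2 _

/-- The global-state labelling function: each event is decorated with the global state reached on
its strict past. -/
noncomputable def globalLabelling (A : AsyncAutomaton D) (t : Trace D) :
    Trace (D.prod A.GlobalState) :=
  t.decorate fun e => A.run (t.strictPast e)

end AsyncAutomaton

/-- An asynchronous (letter-to-letter) `Γ`-transducer: an asynchronous automaton with an output
function on `a`-states for each letter `a`. -/
structure AsyncTransducer {P : Type u} {α : Type v} (D : DistributedAlphabet P α) (Γ : Type*)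
    extends AsyncAutomaton.{u, v, w} D where
  out : (a : α) → ((i : D.loc a) → S i) → Γ

namespace AsyncTransducer

variable {P : Type u} {α : Type v} {D : DistributedAlphabet P α} {Γ : Type*}

/-- The labelling function of a transducer: an event `e` with letter `a` is decorated with the
output at the `a`-state reached on the strict past of `e`. -/
noncomputable def labelling [Nonempty Γ] (T : AsyncTransducer D Γ) (t : Trace D) :
    Trace (D.prod Γ) :=
  t.decorate fun e =>
    T.out (t.label e) (T.toAsyncAutomaton.proj (t.label e) (T.toAsyncAutomaton.run (t.strictPast e)))

/-- The transducer computes the labelling function `θ`. -/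
def Computes [Nonempty Γ] (T : AsyncTransducer D Γ) (θ : Trace D → Trace (D.prod Γ)) : Prop :=
  ∀ t, T.labelling t = θ t

/-- The restricted local cascade product: it runs the transducer `G` on the input, and runs `B` on
the trace that `G` outputs. -/
def restrictedCascade [Nonempty Γ] (G : AsyncTransducer D Γ) (B : AsyncAutomaton (D.prod Γ)) :
    AsyncAutomaton D where
  S i := G.S i × B.S i
  finite _ := inferInstance
  δ a r i :=
    (G.δ a (fun j => (r j).1) i, B.δ (a, G.out a (fun j => (r j).1)) (fun j => (r j).2) i)
  init i := (G.init i, B.init i)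

end AsyncTransducer

/-- A way of choosing, for each letter `a`, each `γ ∈ {0,1}^(P × P)` and each process `i`, some
`j ∈ loc a` with `γ (i, j) = 1` whenever there is one. -/
def Chooser {P : Type u} {α : Type v} (D : DistributedAlphabet P α) :=
  (a : α) → (γ : P × P → Bool) → (i : P) → (∃ j : D.loc a, γ (i, j) = true) →
    {j : D.loc a // γ (i, j) = true}

namespace AsyncAutomaton

variable {P : Type u} {α : Type v} {D : DistributedAlphabet P α}

open Classical in
/-- The best global state collectively known to the processes in `loc a`, where each `j ∈ loc a`
knows the global state `q j`, according to the information `γ`. -/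
noncomputable def globalState (A : AsyncAutomaton D) (c : Chooser D) (a : α) (γ : P × P → Bool)
    (q : D.loc a → A.GlobalState) : A.GlobalState :=
  fun i => if h : ∃ j : D.loc a, γ (i, j) = true then q (c a γ i h).1 i else A.init i

/-- The global-state detector of `A`: the local states of each process are the global states of
`A`, and the processes that meet at an `(a, γ)`-event all move to the result of executing `a` in the
best global state that they collectively know. -/
noncomputable def detector [Finite P] (A : AsyncAutomaton.{u, v, w} D) (c : Chooser D) :
    AsyncAutomaton.{u, max u v, max u w} (D.prod (P × P → Bool)) where
  S _ := A.GlobalState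
  finite _ := inferInstance
  δ p q _ := A.step p.1 (A.globalState c p.1 p.2 q)
  init _ := A.init

/-- The restricted local cascade product of `G` with the global-state detector of `A`. -/
noncomputable def detectorCascade [Finite P] (A : AsyncAutomaton.{u, v, w} D) (c : Chooser D)
    (G : AsyncTransducer.{u, v, w'} D (P × P → Bool)) :
    AsyncAutomaton.{u, v, max u w w'} D :=
  G.restrictedCascade (A.detector c)

/-- The transducer built on the restricted local cascade product of `G` with the global-state
detector of `A`: at an `a`-state, it outputs the best global state of `A` collectively known to the
processes in `loc a`. -/
noncomputable def detectorTransducer [Finite P] (A : AsyncAutomaton.{u, v, w} D) (c : Chooser D)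
    (G : AsyncTransducer.{u, v, w'} D (P × P → Bool)) :
    AsyncTransducer.{u, v, max u w w'} D A.GlobalState where
  toAsyncAutomaton := A.detectorCascade c G
  out a r := A.globalState c a (G.out a fun j => (r j).1) fun j => (r j).2

end AsyncAutomaton

/-! Invariant: on every prefix `s`, the detector state of process `i` is the state of `A` on the
`i`-view `t.viewOf s i`. The views in strict pasts are handled by well-founded induction on events.
Let `e` be an event whose participants know their views of `Iio e`. If `Iio e` has a last `i`-event
`f`, then `f` lies below an event covered by `e`, which is shared with some participant `j`
(`exists_dep_of_lt`). So `f` is below the last `j`-event, and the primary order reports this. For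
any `j` so reported, `f` is also the last `i`-event of the `j`-view, and the last `i`-event
determines the `i`-component (`run_viewOf_apply`). If no `j` is reported, there is no `i`-event and
the component is initial. Thus `globalState` returns exactly the state on the strict past
(`globalState_primaryLe`), and the transition yields the state on `Iic e`, the view of each
participant after `e`. -/

namespace Trace

variable {P : Type u} {α : Type v} {D : DistributedAlphabet P α}

/-! ### Last events, linearizations of prefixes, and views. -/

theorem comparable_of_mem_events (t : Trace D) {i : P} {e f : t.E} (he : e ∈ t.events i)
    (hf : f ∈ t.events i) : e ≤ f ∨ f ≤ e :=
  t.comparable_of_dep e f ⟨i, he, hf⟩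

/-- The `i`-events in a set of events are a finite chain, so there is a last one if there is any. -/
theorem exists_isGreatest_events (t : Trace D) (c : Set t.E) (i : P)
    (h : (c ∩ t.events i).Nonempty) : ∃ e, IsGreatest (c ∩ t.events i) e := by
  obtain ⟨e, he⟩ := (Set.toFinite (c ∩ t.events i)).exists_maximal h
  refine ⟨e, he.prop, fun f hf => ?_⟩
  rcases t.comparable_of_mem_events he.prop.2 hf.2 with h₁ | h₁
  · exact he.le_of_ge hf h₁
  · exact h₁

/-- A linearization of an arbitrary set of events. -/
theorem exists_list (t : Trace D) (c : Set t.E) :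
    ∃ l : List t.E, (∀ e, e ∈ l ↔ e ∈ c) ∧ l.Pairwise (fun e f => ¬ f ≤ e) := by
  classical
  obtain ⟨l, hl, hp⟩ := t.exists_isLinearization
  exact ⟨l.filter (· ∈ c), fun e => by simp [hl], hp.filter _⟩

/-- `Computes` equates whole traces; as both decorations live on the same poset, the equality
descends to the added labels. -/
theorem decorate_injective (t : Trace D) {Γ : Type*} [Nonempty Γ] {μ ν : t.E → Γ}
    (h : t.decorate μ = t.decorate ν) : μ = ν := by
  unfold decorate at h
  injection h with _ _ h
  funext e
  exact congrArg Prod.snd (congrFun h e)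

/-- Every event strictly below `e` is below some event that is strictly below `e` and depends
on `e`. -/
theorem exists_dep_of_lt (t : Trace D) {e f : t.E} (h : f < e) :
    ∃ g, f ≤ g ∧ g < e ∧ ∃ j ∈ D.loc (t.label e), g ∈ t.events j := by
  -- A maximal element of the interval from `f` to `e`, with `e` excluded, is covered by `e`, hence
  -- dependent on it.
  obtain ⟨g, hg⟩ := (Set.toFinite {g | f ≤ g ∧ g < e}).exists_maximal ⟨f, le_rfl, h⟩
  have hcov : g ⋖ e := ⟨hg.prop.2, fun k h₁ h₂ =>
    h₁.not_ge (hg.le_of_ge ⟨hg.prop.1.trans h₁.le, h₂⟩ h₁.le)⟩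
  obtain ⟨j, h₁, h₂⟩ := t.dep_of_covBy g e hcov
  exact ⟨g, hg.prop.1, hg.prop.2, j, h₂, h₁⟩

/-- The prefix of all events below some `i`-event in `c`. -/
def viewOf (t : Trace D) (c : Set t.E) (i : P) : Trace D :=
  t.restrict (lowerClosure (c ∩ t.events i)) (lowerClosure (c ∩ t.events i)).lower

end Trace

/-! ### Runs on prefixes and on views. -/

namespace AsyncAutomaton

variable {P : Type u} {α : Type v} {D : DistributedAlphabet P α}

/-- Lets all prefixes of `t` be run along lists of events of `t` itself, avoiding lists over
subtypes. -/
theorem run_restrict_eq (A : AsyncAutomaton D) (t : Trace D) {c : Set t.E} (hc : IsLowerSet c)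
    {l : List t.E} (hl : ∀ e, e ∈ l ↔ e ∈ c) (hp : l.Pairwise (fun e f => ¬ f ≤ e)) :
    A.run (t.restrict c hc) = A.stepWord (l.map t.label) A.init := by
  have hm : ∀ e ∈ l, e ∈ c := fun e he => (hl e).1 he
  let l' : List (t.restrict c hc).E := l.attachWith (· ∈ c) hm
  have hval : l'.map Subtype.val = l := List.attachWith_map_subtype_val _
  have hlin : (t.restrict c hc).IsLinearization l' := by
    refine ⟨fun e => (List.mem_attachWith _ _).2 ((hl _).2 e.2), ?_⟩
    rw [← hval, List.pairwise_map] at hp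
    exact hp
  rw [A.run_eq _ l' hlin]
  conv_rhs => rw [← hval, List.map_map]
  rfl

theorem run_restrict_congr (A : AsyncAutomaton D) (t : Trace D) {c d : Set t.E}
    (hc : IsLowerSet c) (hd : IsLowerSet d) (h : c = d) :
    A.run (t.restrict c hc) = A.run (t.restrict d hd) := by
  subst h; rfl

theorem run_restrict_univ (A : AsyncAutomaton D) (t : Trace D) :
    A.run (t.restrict Set.univ isLowerSet_univ) = A.run t := by
  obtain ⟨l, hl, hp⟩ := t.exists_isLinearization
  rw [A.run_eq t l ⟨hl, hp⟩, A.run_restrict_eq t isLowerSet_univ (l := l) (by simpa using hl) hp]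

theorem step_apply_of_notMem (A : AsyncAutomaton D) {a : α} {i : P} (h : i ∉ D.loc a)
    (s : A.GlobalState) : A.step a s i = s i :=
  dif_neg h

theorem stepWord_apply_of_notMem (A : AsyncAutomaton D) {i : P} (w : List α)
    (h : ∀ a ∈ w, i ∉ D.loc a) (s : A.GlobalState) : A.stepWord w s i = s i := by
  induction w generalizing s with
  | nil => rfl
  | cons a w ih =>
    rw [List.forall_mem_cons] at h
    exact (ih h.2 (A.step a s)).trans (A.step_apply_of_notMem h.1 s)

/-- A process without events is in its initial state. -/
theorem run_restrict_apply_of_empty (A : AsyncAutomaton D) (t : Trace D) {c : Set t.E}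
    (hc : IsLowerSet c) {i : P} (h : ¬ (c ∩ t.events i).Nonempty) :
    A.run (t.restrict c hc) i = A.init i := by
  obtain ⟨l, hl, hp⟩ := t.exists_list c
  rw [A.run_restrict_eq t hc hl hp]
  refine A.stepWord_apply_of_notMem _ (fun a ha hi => ?_) _
  obtain ⟨e, he, rfl⟩ := List.mem_map.1 ha
  exact h ⟨e, (hl e).1 he, hi⟩

/-- The state of a process is determined by its last event. -/
theorem run_restrict_apply_of_isGreatest (A : AsyncAutomaton D) (t : Trace D) {c : Set t.E}
    (hc : IsLowerSet c) {i : P} {e : t.E} (h : IsGreatest (c ∩ t.events i) e) :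
    A.run (t.restrict c hc) i = A.step (t.label e) (A.run (t.strictPast e)) i := by
  -- Linearize `c` as the strict past of `e`, then `e`, then the events of `c` not below `e`; the
  -- last block has no `i`-event and leaves component `i` alone.
  obtain ⟨l, hl, hp⟩ := t.exists_list (Set.Iio e)
  obtain ⟨m, hm, hq⟩ := t.exists_list (c \ Set.Iic e)
  have hlm : ∀ f, f ∈ l ++ e :: m ↔ f ∈ c := by
    intro f
    rw [List.mem_append, List.mem_cons, hl, hm]
    constructor
    · rintro (h₁ | rfl | h₁)
      · exact hc (le_of_lt h₁) h.1.1
      · exact h.1.1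
      · exact h₁.1
    · intro hf
      by_cases h₁ : f ≤ e
      · rcases h₁.lt_or_eq with h₂ | h₂
        · exact Or.inl h₂
        · exact Or.inr (Or.inl h₂)
      · exact Or.inr (Or.inr ⟨hf, h₁⟩)
  have hpq : (l ++ e :: m).Pairwise (fun e f => ¬ f ≤ e) := by
    refine List.pairwise_append.2 ⟨hp, List.pairwise_cons.2 ⟨fun f hf => ((hm f).1 hf).2, hq⟩, ?_⟩
    intro f hf g hg hgf
    have hfe : f < e := (hl f).1 hf
    rcases List.mem_cons.1 hg with rfl | hg
    · exact hfe.not_ge hgf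
    · exact ((hm g).1 hg).2 (hgf.trans hfe.le)
  rw [A.run_restrict_eq t hc hlm hpq, Trace.strictPast,
    A.run_restrict_eq t (isLowerSet_Iio e) hl hp, List.map_append, List.map_cons, stepWord,
    List.foldl_append, List.foldl_cons]
  refine A.stepWord_apply_of_notMem _ (fun a ha hi => ?_) _
  obtain ⟨f, hf, rfl⟩ := List.mem_map.1 ha
  have hf' := (hm f).1 hf
  exact hf'.2 (h.2 ⟨hf'.1, hi⟩)

theorem run_restrict_Iic (A : AsyncAutomaton D) (t : Trace D) (e : t.E) :
    A.run (t.restrict (Set.Iic e) (isLowerSet_Iic e)) =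
      A.step (t.label e) (A.run (t.strictPast e)) := by
  obtain ⟨l, hl, hp⟩ := t.exists_list (Set.Iio e)
  rw [A.run_restrict_eq t (isLowerSet_Iic e) (l := l ++ [e]), Trace.strictPast,
    A.run_restrict_eq t (isLowerSet_Iio e) hl hp, List.map_append, stepWord, List.foldl_append]
  · rfl
  · intro f
    simp [hl, le_iff_lt_or_eq]
  · refine List.pairwise_append.2 ⟨hp, List.pairwise_singleton _ _, fun f hf g hg => ?_⟩
    rw [List.mem_singleton.1 hg]
    exact not_le_of_gt ((hl f).1 hf)

theorem run_viewOf_of_empty (A : AsyncAutomaton D) (t : Trace D) {c : Set t.E} {i : P}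
    (h : ¬ (c ∩ t.events i).Nonempty) : A.run (t.viewOf c i) = A.init := by
  refine A.run_restrict_eq t (lowerClosure _).lower (l := []) ?_ List.Pairwise.nil
  simp [Set.not_nonempty_iff_eq_empty.1 h]

/-- The `i`-view of `c` is `Iic e`, so `e` is executed last. -/
theorem run_viewOf_of_isGreatest (A : AsyncAutomaton D) (t : Trace D) {c : Set t.E} {i : P}
    {e : t.E} (h : IsGreatest (c ∩ t.events i) e) :
    A.run (t.viewOf c i) = A.step (t.label e) (A.run (t.strictPast e)) := by
  rw [← A.run_restrict_Iic]
  refine A.run_restrict_congr t _ _ (Set.ext fun f => ?_)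
  exact ⟨fun ⟨g, hg, hfg⟩ => hfg.trans (h.2 hg), fun hf => ⟨e, h.1, hf⟩⟩

/-- If the last `i`-event in `c` is below the last `j`-event in `c`, then the `j`-view of `c`
determines the `i`-component of the state on `c`. -/
theorem run_viewOf_apply (A : AsyncAutomaton D) (t : Trace D) {c : Set t.E} (hc : IsLowerSet c)
    {i j : P} {f g : t.E} (hf : IsGreatest (c ∩ t.events i) f)
    (hg : IsGreatest (c ∩ t.events j) g) (h : f ≤ g) :
    A.run (t.viewOf c j) i = A.run (t.restrict c hc) i := by
  rw [A.run_restrict_apply_of_isGreatest t hc hf]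
  -- `f` is also the last `i`-event of the `j`-view: it lies below `g`, and the view is contained in
  -- `c`.
  refine A.run_restrict_apply_of_isGreatest t _ ⟨⟨⟨g, hg.1, h⟩, hf.1.2⟩, fun k hk => hf.2 ⟨?_, hk.2⟩⟩
  obtain ⟨m, hm, hkm⟩ := hk.1
  exact hc hkm hm.1

open Classical in
/-- The processes of an event collectively know the global state on its strict past, and the primary
order tells which of them knows which component. -/
theorem globalState_primaryLe (A : AsyncAutomaton D) (c : Chooser D) (t : Trace D) (e : t.E) :
    A.globalState c (t.label e) (fun p => decide (t.PrimaryLe e p.1 p.2))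
      (fun j => A.run (t.viewOf (Set.Iio e) j)) = A.run (t.strictPast e) := by
  funext i
  unfold globalState
  split_ifs with h
  · obtain ⟨f, g, hf, hg, hfg⟩ := of_decide_eq_true
      (c (t.label e) (fun p => decide (t.PrimaryLe e p.1 p.2)) i h).2
    exact A.run_viewOf_apply t (isLowerSet_Iio e) hf hg hfg
  -- Contrapositive: a last `i`-event in the strict past would be below the last event `k` of some
  -- participant `j`, making `γ (i, j)` true.
  · refine (A.run_restrict_apply_of_empty t _ fun hne => h ?_).symm
    obtain ⟨f, hf⟩ := t.exists_isGreatest_events _ i hne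
    obtain ⟨g, hfg, hge, j, hj, hgj⟩ := t.exists_dep_of_lt hf.1.1
    obtain ⟨k, hk⟩ := t.exists_isGreatest_events (Set.Iio e) j ⟨g, hge, hgj⟩
    exact ⟨⟨j, hj⟩, decide_eq_true ⟨f, k, hf, hk, hfg.trans (hk.2 ⟨hge, hgj⟩)⟩⟩

end AsyncAutomaton

/-! ### Projection of the cascade product to its first factor. -/

namespace AsyncTransducer

variable {P : Type u} {α : Type v} {D : DistributedAlphabet P α} {Γ : Type*} [Nonempty Γ]

theorem restrictedCascade_stepWord_fst (G : AsyncTransducer D Γ)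
    (B : AsyncAutomaton (D.prod Γ)) (w : List α) (s : (G.restrictedCascade B).GlobalState) :
    (fun i => ((G.restrictedCascade B).stepWord w s i).1) =
      G.stepWord w (fun i => (s i).1) := by
  induction w generalizing s with
  | nil => rfl
  | cons a w ih =>
    refine (ih ((G.restrictedCascade B).step a s)).trans (congrArg (G.stepWord w) ?_)
    funext i
    by_cases h : i ∈ D.loc a
    · simp only [AsyncAutomaton.step, dif_pos h]
      rfl
    · simp only [AsyncAutomaton.step, dif_neg h]

/-- The first component of the cascade product runs the transducer on the input. -/
theorem restrictedCascade_run_fst (G : AsyncTransducer D Γ) (B : AsyncAutomaton (D.prod Γ))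
    (t : Trace D) :
    (fun i => ((G.restrictedCascade B).run t i).1) = G.run t :=
  G.restrictedCascade_stepWord_fst B _ _

end AsyncTransducer

/-! ### The invariant of the detector. -/

namespace AsyncAutomaton

variable {P : Type u} {α : Type v} [Finite P] {D : DistributedAlphabet P α}

open Classical in
/-- A transducer computing the primary order outputs it at the states of the cascade product. -/
theorem out_detectorCascade_run (A : AsyncAutomaton.{u, v, w} D) (c : Chooser D)
    {G : AsyncTransducer.{u, v, w'} D (P × P → Bool)} (hG : G.Computes Trace.primaryOrder)
    (t : Trace D) (e : t.E) :
    G.out (t.label e) (fun j => ((A.detectorCascade c G).run (t.strictPast e) j).1) =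
      fun p => decide (t.PrimaryLe e p.1 p.2) := by
  have h := congrFun (t.decorate_injective (hG t)) e
  -- `hG` speaks of the run of `G` alone, which is the first component of the cascade run.
  rw [← G.restrictedCascade_run_fst (A.detector c)] at h
  exact h

theorem detectorCascade_step_snd (A : AsyncAutomaton.{u, v, w} D) (c : Chooser D)
    (G : AsyncTransducer.{u, v, w'} D (P × P → Bool)) {a : α} {i : P} (h : i ∈ D.loc a)
    (s : (A.detectorCascade c G).GlobalState) :
    ((A.detectorCascade c G).step a s i).2 =
      A.step a (A.globalState c a (G.out a fun j => (s j).1) fun j => (s j).2) := by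
  rw [step, dif_pos h]
  rfl

/-- The output at an event is the global state on its strict past, if every process knows its
view. -/
theorem globalState_detectorCascade (A : AsyncAutomaton.{u, v, w} D) (c : Chooser D)
    {G : AsyncTransducer.{u, v, w'} D (P × P → Bool)} (hG : G.Computes Trace.primaryOrder)
    (t : Trace D) (e : t.E)
    (h : ∀ j, ((A.detectorCascade c G).run (t.strictPast e) j).2 =
      A.run (t.viewOf (Set.Iio e) j)) :
    A.globalState c (t.label e)
      (G.out (t.label e) fun j => ((A.detectorCascade c G).run (t.strictPast e) j).1)
      (fun j => ((A.detectorCascade c G).run (t.strictPast e) j).2) = A.run (t.strictPast e) := by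
  rw [A.out_detectorCascade_run c hG t e, funext fun j : D.loc (t.label e) => h j]
  exact A.globalState_primaryLe c t e

/-- The last `i`-event of `s` determines both sides, so correctness at the strict pasts of events in
`s` suffices. The prefix is arbitrary so as to serve both the induction (`s = Iio e`) and the whole
trace (`s = univ`). -/
theorem detectorCascade_run_snd_of_forall (A : AsyncAutomaton.{u, v, w} D) (c : Chooser D)
    {G : AsyncTransducer.{u, v, w'} D (P × P → Bool)} (hG : G.Computes Trace.primaryOrder)
    (t : Trace D) {s : Set t.E} (hs : IsLowerSet s)
    (h : ∀ e ∈ s, ∀ j, ((A.detectorCascade c G).run (t.strictPast e) j).2 =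
      A.run (t.viewOf (Set.Iio e) j)) (i : P) :
    ((A.detectorCascade c G).run (t.restrict s hs) i).2 = A.run (t.viewOf s i) := by
  by_cases hne : (s ∩ t.events i).Nonempty
  · obtain ⟨e, he⟩ := t.exists_isGreatest_events s i hne
    rw [run_restrict_apply_of_isGreatest _ t hs he, A.run_viewOf_of_isGreatest t he,
      A.detectorCascade_step_snd c G he.1.2,
      A.globalState_detectorCascade c hG t e (h e he.1.1)]
  · rw [run_restrict_apply_of_empty _ t hs hne, A.run_viewOf_of_empty t hne]
    rfl

theorem detectorCascade_run_strictPast_snd (A : AsyncAutomaton.{u, v, w} D) (c : Chooser D)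
    {G : AsyncTransducer.{u, v, w'} D (P × P → Bool)} (hG : G.Computes Trace.primaryOrder)
    (t : Trace D) (e : t.E) (i : P) :
    ((A.detectorCascade c G).run (t.strictPast e) i).2 = A.run (t.viewOf (Set.Iio e) i) := by
  induction e using WellFoundedLT.induction generalizing i with
  | ind e ih => exact A.detectorCascade_run_snd_of_forall c hG t _ (fun f hf j => ih f hf j) i

end AsyncAutomaton

theorem theorem7 {P : Type u} {α : Type v} [Finite P] [Finite α] (D : DistributedAlphabet P α)
    (A : AsyncAutomaton.{u, v, w} D) (G : AsyncTransducer.{u, v, w'} D (P × P → Bool))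
    (hG : G.Computes Trace.primaryOrder) (c : Chooser D) :
    (A.detectorTransducer c G).Computes A.globalLabelling ∧
      ∀ (t : Trace D) (i : P), ((A.detectorCascade c G).run t i).2 = A.run (t.view i) := by
  constructor
  · intro t
    refine congrArg t.decorate (funext fun e => ?_)
    exact A.globalState_detectorCascade c hG t e (A.detectorCascade_run_strictPast_snd c hG t e)
  · intro t i
    -- The whole trace is the prefix `Set.univ`, whose `i`-view is `t.view i`.
    rw [← AsyncAutomaton.run_restrict_univ, A.detectorCascade_run_snd_of_forall c hG t _
      fun e _ => A.detectorCascade_run_strictPast_snd c hG t e]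
    exact A.run_restrict_congr t _ _ (by rw [Set.univ_inter])
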